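/- **Setting.** An hour has $M$ settlements. A state is $s=(r,l,b,p)\in\mathcal S=\mathcal R\times\mathcal L\times\mathcal B\times\mathcal P$, with energy level $r\in\mathcal R=\{0,\dots,R_{\max}\}$, remaining lifetime $l\in\mathcal L=\{0,\dots,L_{\max}\}$, previous bid $b=(b^-,b^+)$ in a finite set $\mathcal B\subseteq\{0\le b^-\le b^+\}$, and price state $p$ in a finite set $\mathcal P$. For a price vector $P\in\mathbb R^M$ put $q_m(P,b)=\mathbf 1_{\{b^+<P_m\}}-\mathbf 1_{\{b^->P_m\}}$ and $d_m(P,b)=\mathbf 1_{\{b^+<P_m\}}$. Starting from $r_0=r$, $l_0=l$, the intra-hour levels are $r_m=[\min\{r_{m-1}-q_m,R_{\max}\}]^+$ and $l_m=[l_{m-1}-d_m]^+$ for $1\le m\le M$; write $g^R(r,P,b)=r_M$ and $g^L(l,P,b)=l_M$. With $K\ge 0$ and $\beta:\mathcal L\to[0,1]$ nondecreasing, the hourly revenue is $$C(r,l,P,b)=\sum_{m=1}^M\gamma_m\,P_m\,q_m(P,b)\,U_m,$$ where $\gamma_m=\beta(l_m)$ if $q_m=1$ and $r_m\neq 0$,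 and $\gamma_m=1$ otherwise; and $U_m=-K$ if $q_m=1$ and $r_m=0$, and $U_m=1$ otherwise. Given that the price state at time $t$ is $p$, the nonnegative price vectors $P_{(t,t+1]},P_{(t+1,t+2]}$ of the two coming hours and the next price state $P^S_{t+1}$ have a given joint law. Placing the bid $b'\in\mathcal B$ in state $S_t=(r,l,b,p)$ leads to $R_{t+1}=g^R(r,P_{(t,t+1]},b)$, $L_{t+1}=g^L(l,P_{(t,t+1]},b)$, $S_{t+1}=(R_{t+1},L_{t+1},b',P^S_{t+1})$, and contributes $C_{t,t+2}(S_t,b')=\mathbf E[C(R_{t+1},L_{t+1},P_{(t+1,t+2]},b')\mid S_t]$; this expectation is assumed to exist. Let $C_{\mathrm{term}}:\mathcal S\to\mathbb R$ be nondecreasing in $(r,l,b^-,b^+)$. The optimal value function is given by $V_T^*=C_{\mathrm{term}}$ and $$V_t^*(s)=\max_{b'\in\mathcal B}\bigl[C_{t,t+2}(s,b')+\mathbf E[V_{t+1}^*(S_{t+1})\mid S_t=s]\bigr],\qquad t=0,\dots,T-1 .$$ **Algorithm.** Write $s\preccurlyeq s'$ if $(r,l,b^-,b^+)\le(r',l',b'^-,b'^+)$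 componentwise and $p=p'$. Let $\Pi_M(S,z,s,v)$ be $z$ if $s=S$, $\max(z,v)$ if $S\preccurlyeq s\ne S$, $\min(z,v)$ if $s\preccurlyeq S\ne s$, and $v$ otherwise. Put $\bar V^0_t=0$ for $t<T$ and $\bar V^n_T=C_{\mathrm{term}}$ for all $n$. In iteration $n\ge1$, for each $t<T$, a state $S^n_t$ is visited, and one observes $$\hat v_t^n(S_t^n)=\max_{b'\in\mathcal B}\bigl[C_{t,t+2}(S_t^n,b')+\mathbf E[\bar V^{n-1}_{t+1}(S_{t+1})\mid S_t=S^n_t]\bigr]+w^n_t(S^n_t),$$ and sets $z^n_t=(1-\alpha_t^n(S_t^n))\bar V_t^{n-1}(S_t^n)+\alpha_t^n(S_t^n)\,\hat v_t^n(S_t^n)$ and $\bar V^n_t(s)=\Pi_M(S_t^n,z_t^n,s,\bar V_t^{n-1}(s))$ for all $s\in\mathcal S$, where $\alpha_t^n(s)=\alpha_t^{n-1}\mathbf 1_{\{s=S_t^n\}}$ for a sequence $\alpha_t^0,\alpha_t^1,\dots$ of random variables. Let $\mathcal F^n$ be generated by the $S^m_t$ ($t\le T$) and $w^m_t(S^m_t)$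 ($t<T$) with $1\le m\le n$. The state $S^n_t$ is chosen given $\mathcal F^{n-1}$: conditionally on $\mathcal F^{n-1}$, it is independent of $w_t^n(s)$ for every $s$. **Theorem.** Assume that for all $t<T$, $s\in\mathcal S$ and $n\ge0$: 1. $\sum_{n\ge1}\mathbf P(S_t^n=s\mid\mathcal F^{n-1})=\infty$ a.s.; 2. for some constant $V_{\max}>0$, $|V^*_{t}|\le V_{\max}$ (also for $t=T$) and $|\hat v_t^{n+1}(S_t^{n+1})|\le V_{\max}$ a.s.; 3. $w_t^{n+1}(s)$ is integrable and $\mathbf E[w_t^{n+1}(s)\mid\mathcal F^n]=0$ a.s.; 4. $\alpha_t^n\in[0,1]$ is $\mathcal F^n$-measurable, $\sum_{n\ge1}\alpha_t^n(s)=\infty$ a.s. and $\sum_{n\ge1}\alpha_t^n(s)^2<\infty$ a.s. Then for each $t\le T$ and $s\in\mathcal S$, $\bar V_t^n(s)\to V_t^*(s)$ almost surely as $n\to\infty$. -/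

import Mathlib

open MeasureTheory ProbabilityTheory Filter Topology

namespace Bidding

/-- A state `(R_t, L_t, b_{t-1}, P^S_t)`: stored energy in `{0,…,Rmax}`, remaining lifetime in
`{0,…,Lmax}`, the previous bid `(b⁻, b⁺)` (an element of the finite set `bids`), price state. -/
@[ext]
structure State (Rmax Lmax : ℕ) (bids : Finset (ℝ × ℝ)) (PS : Type*) where
  r : Fin (Rmax + 1)
  l : Fin (Lmax + 1)
  b : bids
  p : PS

namespace State

variable {Rmax Lmax : ℕ} {bids : Finset (ℝ × ℝ)} {PS : Type*}

/-- The state space is finite and carries the discrete σ-algebra. -/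
instance : MeasurableSpace (State Rmax Lmax bids PS) := ⊤

/-- The partial order `s ≼ s'`: `(r, l, b⁻, b⁺) ≤ (r', l', b'⁻, b'⁺)` componentwise and `p = p'`. -/
def Below (s s' : State Rmax Lmax bids PS) : Prop :=
  s.r ≤ s'.r ∧ s.l ≤ s'.l ∧ s.b.1.1 ≤ s'.b.1.1 ∧ s.b.1.2 ≤ s'.b.1.2 ∧ s.p = s'.p

open scoped Classical in
/-- The monotonicity preserving operator `Π_M(S, z, s, v)`. -/
noncomputable def project (S : State Rmax Lmax bids PS) (z : ℝ) (s : State Rmax Lmax bids PS)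
    (v : ℝ) : ℝ :=
  if s = S then z
  else if S.Below s then max z v
  else if s.Below S then min z v
  else v

end State

/-- The data of the hour-ahead bidding problem. -/
structure Model (PS : Type*) [MeasurableSpace PS] where
  /-- number of settlements per hour -/
  M : ℕ
  /-- battery capacity, in units moved by one settlement -/
  Rmax : ℕ
  /-- initial lifetime -/
  Lmax : ℕ
  /-- the horizon: bids are placed at the times `0, …, T - 1` -/
  T : ℕ
  /-- the finite set of bids `(b⁻, b⁺)` (being finite, it is bounded by some `b_max`) -/
  bids : Finset (ℝ × ℝ)
  bids_ordered : ∀ b ∈ bids, 0 ≤ b.1 ∧ b.1 ≤ b.2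
  /-- undersupply penalty factor -/
  K : ℝ
  K_nonneg : 0 ≤ K
  /-- discount of the sales revenue, as a function of the remaining lifetime -/
  β : Fin (Lmax + 1) → ℝ
  β_mem : ∀ l, β l ∈ Set.Icc (0 : ℝ) 1
  β_mono : Monotone β
  /-- terminal contribution -/
  Cterm : State Rmax Lmax bids PS → ℝ
  Cterm_mono : ∀ s s', s.Below s' → Cterm s ≤ Cterm s'
  /-- `law t p` is the conditional law of `(P_{(t,t+1]}, P_{(t+1,t+2]}, P^S_{t+1})`, the intra-hour
  prices of the two coming hours and the next price state, given `P^S_t = p`. -/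
  law : ℕ → PS → Measure ((Fin M → ℝ) × (Fin M → ℝ) × PS)
  law_prob : ∀ t p, IsProbabilityMeasure (law t p)
  /-- prices are nonnegative -/
  law_nonneg : ∀ t p, ∀ᵐ x ∂(law t p), (∀ m, 0 ≤ x.1 m) ∧ (∀ m, 0 ≤ x.2.1 m)

namespace Model

variable {PS : Type*} [MeasurableSpace PS] (D : Model PS)

/-- The states of the model. -/
abbrev S : Type _ := State D.Rmax D.Lmax D.bids PS

/-- Settlement outcome `q_m(P, b)`: discharge `1`, charge `-1`, idle `0`. -/
noncomputable def q (P : Fin D.M → ℝ) (b : D.bids) (m : Fin D.M) : ℤ :=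
  (if b.1.2 < P m then 1 else 0) - (if P m < b.1.1 then 1 else 0)

/-- Discharge indicator `d_m(P, b)`. -/
noncomputable def d (P : Fin D.M → ℝ) (b : D.bids) (m : Fin D.M) : ℤ :=
  if b.1.2 < P m then 1 else 0

/-- One settlement of the energy level: `[min {r - q, Rmax}]⁺`. -/
def stepR (r : Fin (D.Rmax + 1)) (q : ℤ) : Fin (D.Rmax + 1) :=
  ⟨(max (min ((r : ℤ) - q) (D.Rmax : ℤ)) 0).toNat, by omega⟩

/-- One settlement of the lifetime: `[l - d]⁺`, for `d ∈ {0, 1}`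
(the cap at `Lmax` is never active then). -/
def stepL (l : Fin (D.Lmax + 1)) (d : ℤ) : Fin (D.Lmax + 1) :=
  ⟨(max (min ((l : ℤ) - d) (D.Lmax : ℤ)) 0).toNat, by omega⟩

/-- `g^R_m`: energy level after `m` settlements with outcomes `qs` (constant for `m ≥ M`). -/
def gR (r : Fin (D.Rmax + 1)) (qs : Fin D.M → ℤ) : ℕ → Fin (D.Rmax + 1)
  | 0 => r
  | m + 1 => if h : m < D.M then D.stepR (gR r qs m) (qs ⟨m, h⟩) else gR r qs m

/-- `g^L_m`: lifetime after `m` settlements with discharge indicators `ds`. -/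
def gL (l : Fin (D.Lmax + 1)) (ds : Fin D.M → ℤ) : ℕ → Fin (D.Lmax + 1)
  | 0 => l
  | m + 1 => if h : m < D.M then D.stepL (gL l ds m) (ds ⟨m, h⟩) else gL l ds m

/-- Hourly energy transition. -/
noncomputable def nextR (r : Fin (D.Rmax + 1)) (P : Fin D.M → ℝ) (b : D.bids) :
    Fin (D.Rmax + 1) :=
  D.gR r (D.q P b) D.M

/-- Hourly lifetime transition. -/
noncomputable def nextL (l : Fin (D.Lmax + 1)) (P : Fin D.M → ℝ) (b : D.bids) :
    Fin (D.Lmax + 1) :=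
  D.gL l (D.d P b) D.M

/-- Discount factor: `β l` when energy is sold to the market (an obligation to sell is met),
`1` otherwise; in particular an undersupply penalty is not discounted. -/
noncomputable def γ (r : Fin (D.Rmax + 1)) (l : Fin (D.Lmax + 1)) (q : ℤ) : ℝ :=
  if q = 1 ∧ r ≠ 0 then D.β l else 1

/-- Undersupply factor: `-K` when there is an obligation to sell and the level is `0`, else `1`. -/
noncomputable def U (r : Fin (D.Rmax + 1)) (q : ℤ) : ℝ :=
  1 - (D.K + 1) * (if r = 0 then 1 else 0) * (if q = 1 then 1 else 0)

/-- The hourly revenue `C(r, l, P, b)`: sum over the settlements `1, …, M` (the `m`-th one is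
indexed by `m - 1`), with the levels reached at the settlement times. -/
noncomputable def revenue (r : Fin (D.Rmax + 1)) (l : Fin (D.Lmax + 1)) (P : Fin D.M → ℝ)
    (b : D.bids) : ℝ :=
  ∑ m : Fin D.M,
    D.γ (D.gR r (D.q P b) (m + 1)) (D.gL l (D.d P b) (m + 1)) (D.q P b m) * P m *
      (D.q P b m : ℝ) * D.U (D.gR r (D.q P b) (m + 1)) (D.q P b m)

/-- Revenue of the hour `(t+1, t+2]` when the bid `b` is placed in state `s` at time `t`, as a
function of the prices `P` of `(t, t+1]` and `P'` of `(t+1, t+2]`. -/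
noncomputable def nextRevenue (s : D.S) (b : D.bids) (P P' : Fin D.M → ℝ) : ℝ :=
  D.revenue (D.nextR s.r P s.b) (D.nextL s.l P s.b) P' b

/-- The contribution function `C_{t,t+2}(s, b) = E[C(R_{t+1}, L_{t+1}, P_{(t+1,t+2]}, b) | S_t = s]`. -/
noncomputable def contribution (t : ℕ) (s : D.S) (b : D.bids) : ℝ :=
  ∫ x, D.nextRevenue s b x.1 x.2.1 ∂(D.law t s.p)

/-- The state transition function `S^M`: next state when the bid `b` is placed in state `s`, the
prices of the hour are `P`, and the next price state is `p'`. -/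
noncomputable def transition (s : D.S) (b : D.bids) (P : Fin D.M → ℝ) (p' : PS) : D.S :=
  ⟨D.nextR s.r P s.b, D.nextL s.l P s.b, b, p'⟩

/-- `E[V(S_{t+1}) | S_t = s]` when the bid `b` is placed at time `t`. -/
noncomputable def expectedNext (t : ℕ) (V : D.S → ℝ) (s : D.S) (b : D.bids) : ℝ :=
  ∫ x, V (D.transition s b x.1 x.2.2) ∂(D.law t s.p)

/-- `max_{b ∈ ℬ} [C_{t,t+2}(s, b) + E[V(S_{t+1}) | S_t = s]]`. -/
noncomputable def bellman (t : ℕ) (V : D.S → ℝ) (s : D.S) : ℝ :=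
  Finset.univ.sup' ⟨s.b, Finset.mem_univ _⟩
    (fun b : D.bids => D.contribution t s b + D.expectedNext t V s b)

/-- The optimal value function `V*_t`, `t ≤ T`, by Bellman's optimality equation. -/
noncomputable def optimalValue (t : ℕ) : D.S → ℝ :=
  if _h : t < D.T then D.bellman t (optimalValue (t + 1)) else D.Cterm
termination_by D.T - t

/-- Observation `v̂` of the value of state `s` at time `t` with noise `w`, when the current
estimates of the value function at time `t + 1` are `V`. -/
noncomputable def observe (t : ℕ) (V : D.S → ℝ) (s : D.S) (w : ℝ) : ℝ :=
  D.bellman t V s + w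

/-- The estimates `V̄^n_t` of the pre-decision Monotone-ADP-Bidding algorithm along one run.
Inputs: visited states `X n t = S_t^n`, noise `w n t s = w_t^n(s)`, stepsizes `a n t = α_t^n`.
In iteration `n + 1` the stepsize at the visited state is `α_t^n`. -/
noncomputable def estimate (X : ℕ → ℕ → D.S) (w : ℕ → ℕ → D.S → ℝ) (a : ℕ → ℕ → ℝ) :
    ℕ → ℕ → D.S → ℝ
  | 0, t, s => if t < D.T then 0 else D.Cterm s
  | n + 1, t, s =>
      if t < D.T then
        let visited := X (n + 1) t
        let v := D.observe t (estimate X w a n (t + 1)) visited (w (n + 1) t visited)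
        let z := (1 - a n t) * estimate X w a n t visited + a n t * v
        State.project visited z s (estimate X w a n t s)
      else D.Cterm s

variable {Ω : Type*}

/-- The history `𝓕^n = σ((S_t^m, w_t^m(S_t^m)), 1 ≤ m ≤ n, t ≤ T)`; there is no noise at `t = T`,
since nothing is observed at that time. -/
@[reducible] def history (X : ℕ → ℕ → Ω → D.S) (w : ℕ → ℕ → D.S → Ω → ℝ) (n : ℕ) : MeasurableSpace Ω :=
  ⨆ m ∈ Set.Icc 1 n,
    (⨆ t ∈ Set.Iic D.T, MeasurableSpace.comap (X m t) inferInstance) ⊔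
    (⨆ t ∈ Set.Iio D.T, MeasurableSpace.comap (fun ω => w m t (X m t ω) ω) inferInstance)

end Model

/-- `X` (with values in a finite set) and the real random variable `Y` are conditionally
independent given the σ-algebra `m`. -/
def CondIndepGiven {Ω E : Type*} {mΩ : MeasurableSpace Ω} (μ : Measure Ω) (m : MeasurableSpace Ω)
    (X : Ω → E) (Y : Ω → ℝ) : Prop :=
  ∀ (x : E) (A : Set ℝ), MeasurableSet A →
    μ⟦X ⁻¹' {x} ∩ Y ⁻¹' A | m⟧ =ᵐ[μ] fun ω => (μ⟦X ⁻¹' {x} | m⟧) ω * (μ⟦Y ⁻¹' A | m⟧) ω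

end Bidding

/-! Backward induction on time. If the estimates at `t + 1` converge, so do the Bellman values
computed from them, because the state space is finite. At time `t` the algorithm is then stochastic
approximation of the optimal value, with a vanishing bias, martingale noise, and the corrections
made by the monotonicity operator.

The corrections are harmless because the optimal value is itself monotone. For an upper bound at
`s`, only a correction coming from a state `s'` strictly below `s` matters. By well-founded
induction the estimate at `s'` is eventually at most about the optimal value of `s'`, which is at
most that of `s`. The lower bound is the same argument with signs and order reversed. This is
pathwise: `stochasticApproximation_tendsto`, fed by `optimalValue_mono` and `tendsto_bellman`.

Probability enters only to show that the weighted noise at each state has convergent partial sums.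
Conditional independence makes these terms martingale differences (`condExp_indicator_eq_zero`).
Bounded observations bound the noise at the visited state, so the terms are dominated by a multiple
of the square summable stepsizes (`ae_exists_tendsto_sum_of_summable_sq`). -/

/-! ### Deterministic averaging recursions -/

/-- `∏ (1 - α)` vanishes when `∑ α` diverges, in the form of a recursion. -/
theorem tendsto_zero_of_le_one_sub_mul {α f : ℕ → ℝ}
    (hsum : Tendsto (fun N => ∑ n ∈ Finset.range N, α n) atTop atTop)
    (hf : ∀ n, 0 ≤ f n) {N₀ : ℕ} (hrec : ∀ n ≥ N₀, f (n + 1) ≤ (1 - α n) * f n) :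
    Tendsto f atTop (𝓝 0) := by
  set A : ℕ → ℝ := fun N => ∑ n ∈ Finset.range N, α n with hA
  have key : ∀ n ≥ N₀, f n ≤ (f N₀ * Real.exp (A N₀)) * Real.exp (-A n) := by
    intro n hn
    induction n, hn using Nat.le_induction with
    | base => rw [mul_assoc, ← Real.exp_add]; simp
    | succ n hn ih =>
      have h1 : A (n + 1) = A n + α n := Finset.sum_range_succ _ _
      have h2 : 1 - α n ≤ Real.exp (-α n) := by
        have := Real.add_one_le_exp (-α n); linarith
      calc f (n + 1) ≤ (1 - α n) * f n := hrec n hn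
        _ ≤ Real.exp (-α n) * ((f N₀ * Real.exp (A N₀)) * Real.exp (-A n)) :=
            mul_le_mul h2 ih (hf n) (Real.exp_pos _).le
        _ = _ := by rw [h1, neg_add, Real.exp_add]; ring
  have hlim : Tendsto (fun n => (f N₀ * Real.exp (A N₀)) * Real.exp (-A n)) atTop (𝓝 0) := by
    simpa using (Real.tendsto_exp_neg_atTop_nhds_zero.comp hsum).const_mul
      (f N₀ * Real.exp (A N₀))
  exact squeeze_zero' (Eventually.of_forall hf)
    (eventually_atTop.2 ⟨N₀, key⟩) hlim

/-- The excess of `g` over the level `δ / 2` contracts by the factor `1 - α n`; the alternative `δ`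
in the maximum, taken at that level, leaves no excess. It accommodates corrections coming from other
states. -/
theorem eventually_le_of_averaging {α g : ℕ → ℝ} (hα : ∀ n, α n ∈ Set.Icc (0 : ℝ) 1)
    (hsum : Tendsto (fun N => ∑ n ∈ Finset.range N, α n) atTop atTop)
    (hrec : ∀ δ > 0, ∀ᶠ n in atTop, g (n + 1) ≤ max ((1 - α n) * g n + α n * δ) δ) :
    ∀ δ > 0, ∀ᶠ n in atTop, g n ≤ δ := by
  intro δ hδ
  obtain ⟨N₀, hN⟩ := eventually_atTop.1 (hrec (δ / 2) (by positivity))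
  have hlim : Tendsto (fun n => max (g n - δ / 2) 0) atTop (𝓝 0) := by
    refine tendsto_zero_of_le_one_sub_mul hsum (fun n => le_max_right _ _) (N₀ := N₀) ?_
    intro n hn
    have h0 := (hα n).1
    have h1 := (hα n).2
    have hm : (1 - α n) * (g n - δ / 2) ≤ (1 - α n) * max (g n - δ / 2) 0 :=
      mul_le_mul_of_nonneg_left (le_max_left _ _) (by linarith)
    have hp : 0 ≤ (1 - α n) * max (g n - δ / 2) 0 :=
      mul_nonneg (by linarith) (le_max_right _ _)
    refine max_le ?_ hp
    rcases le_max_iff.1 (hN n hn) with h | h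
    · nlinarith
    · linarith
  filter_upwards [hlim.eventually (gt_mem_nhds (show (0 : ℝ) < δ / 2 by positivity))] with n hn
  have := (le_max_left (g n - δ / 2) 0).trans_lt hn
  linarith

theorem tendsto_zero_of_averaging {α e h : ℕ → ℝ} (hα : ∀ n, α n ∈ Set.Icc (0 : ℝ) 1)
    (hsum : Tendsto (fun N => ∑ n ∈ Finset.range N, α n) atTop atTop)
    (he : Tendsto e atTop (𝓝 0)) (hrec : ∀ n, h (n + 1) = (1 - α n) * h n + α n * e n) :
    Tendsto h atTop (𝓝 0) := by
  have hb : ∀ δ > 0, ∀ᶠ n in atTop, |h n| ≤ δ := by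
    refine eventually_le_of_averaging hα hsum fun δ hδ => ?_
    have := (tendsto_zero_iff_abs_tendsto_zero _).1 he
    filter_upwards [this.eventually (gt_mem_nhds hδ)] with n hn
    refine le_max_of_le_left ?_
    rw [hrec]
    refine (abs_add_le _ _).trans ?_
    rw [abs_mul, abs_mul, abs_of_nonneg (hα n).1, abs_of_nonneg (sub_nonneg.2 (hα n).2)]
    have := mul_le_mul_of_nonneg_left hn.le (hα n).1
    simp only [Function.comp_apply] at this
    linarith
  rw [Metric.tendsto_atTop]
  intro δ hδ
  obtain ⟨N, hN⟩ := eventually_atTop.1 (hb (δ / 2) (by positivity))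
  exact ⟨N, fun n hn => by
    rw [Real.dist_eq, sub_zero]; exact (hN n hn).trans_lt (by linarith)⟩

/-- Averaged noise. -/
noncomputable def averagedNoise (α ξ : ℕ → ℝ) : ℕ → ℝ
  | 0 => 0
  | n + 1 => (1 - α n) * averagedNoise α ξ n + ξ n

theorem averagedNoise_tendsto_zero {α ξ : ℕ → ℝ} (hα : ∀ n, α n ∈ Set.Icc (0 : ℝ) 1)
    (hsum : Tendsto (fun N => ∑ n ∈ Finset.range N, α n) atTop atTop)
    (hξ : ∃ c, Tendsto (fun N => ∑ n ∈ Finset.range N, ξ n) atTop (𝓝 c)) :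
    Tendsto (averagedNoise α ξ) atTop (𝓝 0) := by
  obtain ⟨c, hc⟩ := hξ
  have h1 : Tendsto (fun N => c - ∑ n ∈ Finset.range N, ξ n) atTop (𝓝 0) := by
    simpa using hc.const_sub c
  -- Adding the tail of the series absorbs `ξ n`: the sum is averaged with the tail itself, which
  -- tends to zero.
  have h2 : Tendsto (fun N => averagedNoise α ξ N + (c - ∑ n ∈ Finset.range N, ξ n)) atTop (𝓝 0) :=
    tendsto_zero_of_averaging hα hsum h1 fun n => by
      rw [Finset.sum_range_succ, averagedNoise]; ring
  simpa using h2.sub h1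

/-! ### Pathwise stochastic approximation with monotone corrections -/

/-- One-sided convergence of stochastic approximation on a finite well-founded set, when the
value of a state can be raised only by its own updates or by those of the states below it. -/
theorem stochasticApproximation_eventually_le {S : Type*} [Finite S] {lt : S → S → Prop}
    (hlt : WellFounded lt) {v : S → ℝ} (hv : ∀ s s', lt s s' → v s ≤ v s')
    {V : ℕ → S → ℝ} {X : ℕ → S} {α ε ξ : S → ℕ → ℝ}
    (hα : ∀ s n, α s n ∈ Set.Icc (0 : ℝ) 1)
    (hα0 : ∀ s n, X n ≠ s → α s n = 0) (hξ0 : ∀ s n, X n ≠ s → ξ s n = 0)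
    (hsum : ∀ s, Tendsto (fun N => ∑ n ∈ Finset.range N, α s n) atTop atTop)
    (hξ : ∀ s, ∃ c, Tendsto (fun N => ∑ n ∈ Finset.range N, ξ s n) atTop (𝓝 c))
    (hε : ∀ s, Tendsto (ε s) atTop (𝓝 0))
    (hself : ∀ s n, X n = s → V (n + 1) s = (1 - α s n) * V n s + α s n * (v s + ε s n) + ξ s n)
    (hother : ∀ s n, X n ≠ s →
      V (n + 1) s ≤ V n s ∨ lt (X n) s ∧ V (n + 1) s ≤ max (V (n + 1) (X n)) (V n s)) :
    ∀ s, ∀ δ > 0, ∀ᶠ n in atTop, V n s ≤ v s + δ := by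
  intro s
  induction s using hlt.induction with
  | _ s ih =>
  have hy := averagedNoise_tendsto_zero (hα s) (hsum s) (hξ s)
  set y := averagedNoise (α s) (ξ s) with hydef
  have hysucc : ∀ n, y (n + 1) = (1 - α s n) * y n + ξ s n := fun n => rfl
  -- Subtracting the averaged noise `y` leaves a recursion driven only by the bias and the
  -- corrections.
  have hd : ∀ δ > 0, ∀ᶠ n in atTop, V n s - v s - y n ≤ δ := by
    refine eventually_le_of_averaging (hα s) (hsum s) fun δ hδ => ?_
    have hδ2 : 0 < δ / 2 := by positivity
    have hlow : ∀ᶠ n in atTop, ∀ s', lt s' s → V n s' ≤ v s' + δ / 2 := by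
      rw [eventually_all]
      intro s'
      by_cases h : lt s' s
      · filter_upwards [ih s' h _ hδ2] with n hn _ using hn
      · exact Eventually.of_forall fun n h' => absurd h' h
    -- The shift by one is needed because a correction uses the value of the visited state after its
    -- update.
    filter_upwards [(tendsto_add_atTop_nat 1).eventually hlow,
      (hε s).eventually (gt_mem_nhds hδ),
      hy.eventually (lt_mem_nhds (show -(δ / 2) < 0 by linarith))] with n h1 h2 h3
    have ha := hα s n
    by_cases hX : X n = s
    · refine le_max_of_le_left ?_
      rw [hself s n hX, hysucc]
      have := mul_le_mul_of_nonneg_left h2.le ha.1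
      linarith
    · rw [hysucc, hα0 s n hX, hξ0 s n hX]
      rcases hother s n hX with h | ⟨hb, h⟩
      · refine le_max_of_le_left ?_
        linarith
      · rcases le_max_iff.1 h with h | h
        -- One `δ / 2` bounds the excess at the lower state, the other bounds `-y n`; monotonicity
        -- of `v` compares the two targets.
        · refine le_max_of_le_right ?_
          have := h1 _ hb
          have := hv _ _ hb
          linarith
        · refine le_max_of_le_left ?_
          linarith
  intro δ hδ
  have hδ2 : 0 < δ / 2 := by positivity
  filter_upwards [hd _ hδ2, hy.eventually (gt_mem_nhds hδ2)] with n h1 h2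
  linarith

/-- Stochastic approximation with monotonicity preserving corrections converges. -/
theorem stochasticApproximation_tendsto {S : Type*} [Finite S] {lt : S → S → Prop}
    (htrans : ∀ s s' s'', lt s s' → lt s' s'' → lt s s'') (hirr : ∀ s, ¬ lt s s)
    {v : S → ℝ} (hv : ∀ s s', lt s s' → v s ≤ v s')
    {V : ℕ → S → ℝ} {X : ℕ → S} {α ε ξ : S → ℕ → ℝ}
    (hα : ∀ s n, α s n ∈ Set.Icc (0 : ℝ) 1)
    (hα0 : ∀ s n, X n ≠ s → α s n = 0) (hξ0 : ∀ s n, X n ≠ s → ξ s n = 0)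
    (hsum : ∀ s, Tendsto (fun N => ∑ n ∈ Finset.range N, α s n) atTop atTop)
    (hξ : ∀ s, ∃ c, Tendsto (fun N => ∑ n ∈ Finset.range N, ξ s n) atTop (𝓝 c))
    (hε : ∀ s, Tendsto (ε s) atTop (𝓝 0))
    (hself : ∀ s n, X n = s → V (n + 1) s = (1 - α s n) * V n s + α s n * (v s + ε s n) + ξ s n)
    (hother : ∀ s n, X n ≠ s → V (n + 1) s = V n s ∨
      lt (X n) s ∧ V (n + 1) s = max (V (n + 1) (X n)) (V n s) ∨
      lt s (X n) ∧ V (n + 1) s = min (V (n + 1) (X n)) (V n s)) (s : S) :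
    Tendsto (fun n => V n s) atTop (𝓝 (v s)) := by
  have : IsTrans S lt := ⟨htrans⟩
  have : Std.Irrefl lt := ⟨hirr⟩
  have hup := stochasticApproximation_eventually_le (lt := lt)
    (Finite.wellFounded_of_trans_of_irrefl lt) hv hα hα0 hξ0 hsum hξ hε hself (by
      intro s n hX
      rcases hother s n hX with h | ⟨hb, h⟩ | ⟨hb, h⟩
      · exact Or.inl h.le
      · exact Or.inr ⟨hb, h.le⟩
      · exact Or.inl (h.trans_le (min_le_right _ _)))
  -- Negating all values and reversing the order exchanges maxima and minima, so the one-sided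
  -- result gives the lower bound.
  have hlow := stochasticApproximation_eventually_le (lt := Function.swap lt)
    (v := fun s => -v s) (V := fun n s => -V n s) (X := X) (ε := fun s n => -ε s n)
    (ξ := fun s n => -ξ s n)
    (Finite.wellFounded_of_trans_of_irrefl _) (fun s s' h => neg_le_neg (hv _ _ h)) hα hα0
    (fun s n h => by simp [hξ0 s n h]) hsum
    (fun s => by
      obtain ⟨c, hc⟩ := hξ s
      exact ⟨-c, by simpa using hc.neg⟩)
    (fun s => by simpa using (hε s).neg)
    (fun s n h => by rw [hself s n h]; ring) (by
      intro s n hX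
      rcases hother s n hX with h | ⟨hb, h⟩ | ⟨hb, h⟩
      · exact Or.inl (neg_le_neg h.ge)
      · exact Or.inl (neg_le_neg ((le_max_right _ _).trans_eq h.symm))
      · exact Or.inr ⟨hb, by rw [h, max_neg_neg]⟩)
  rw [Metric.tendsto_atTop]
  intro δ hδ
  have hδ2 : 0 < δ / 2 := by positivity
  obtain ⟨N, hN⟩ := eventually_atTop.1 ((hup s _ hδ2).and (hlow s _ hδ2))
  refine ⟨N, fun n hn => ?_⟩
  obtain ⟨h1, h2⟩ := hN n hn
  rw [Real.dist_eq, abs_lt]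
  constructor <;> linarith

/-! ### Conditionally centred noise at a randomly chosen state -/

/-- If `X` and the integrable variable `Y` are conditionally independent and `Y` is conditionally
centred, then so is `Y` restricted to the event `X = x`. -/
theorem Bidding.CondIndepGiven.condExp_indicator_eq_zero {Ω E : Type*} {m mΩ : MeasurableSpace Ω}
    {μ : Measure Ω} [IsProbabilityMeasure μ] (hm : m ≤ mΩ) {X : Ω → E} {Y : Ω → ℝ}
    (h : Bidding.CondIndepGiven μ m X Y) {x : E} (hX : MeasurableSet (X ⁻¹' {x}))
    (hY : Measurable Y) (hint : Integrable Y μ) (h0 : μ[Y | m] =ᵐ[μ] 0) :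
    μ[(X ⁻¹' {x}).indicator Y | m] =ᵐ[μ] 0 := by
  set B := X ⁻¹' {x} with hB
  set p : Ω → ℝ := μ⟦B | m⟧ with hp
  have hpm : StronglyMeasurable[m] p := stronglyMeasurable_condExp
  have hpi : Integrable p μ := integrable_condExp
  have hBint : Integrable (B.indicator fun _ => (1 : ℝ)) μ := (integrable_const _).indicator hX
  have hp0 : 0 ≤ᵐ[μ] p := condExp_nonneg
    (Eventually.of_forall fun ω => Set.indicator_nonneg (fun _ _ => zero_le_one) ω)
  have hp1 : ∀ᵐ ω ∂μ, ‖p ω‖ ≤ 1 := by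
    have : p ≤ᵐ[μ] μ[fun _ => (1 : ℝ) | m] := condExp_mono hBint (integrable_const _)
      (Eventually.of_forall fun ω => Set.indicator_le_self' (fun _ _ => zero_le_one) ω)
    rw [condExp_const hm] at this
    filter_upwards [this, hp0] with ω h1 h2
    rwa [Real.norm_of_nonneg h2]
  refine (ae_eq_condExp_of_forall_setIntegral_eq hm (hint.indicator hX)
    (fun _ _ _ => integrableOn_zero) (fun F hF _ => ?_)
    (stronglyMeasurable_zero.aestronglyMeasurable)).symm
  have hF' := hm _ hF
  have hpn : Measurable fun ω => (p ω).toNNReal := (hpm.mono hm).measurable.real_toNNReal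
  -- the two image measures agree
  have hmap : (μ.restrict (F ∩ B)).map Y =
      ((μ.restrict F).withDensity fun ω => ((p ω).toNNReal : ENNReal)).map Y := by
    ext A hA
    have hYA := hY hA
    rw [Measure.map_apply hY hA, Measure.map_apply hY hA, Measure.restrict_apply hYA,
      withDensity_apply _ hYA, Measure.restrict_restrict hYA]
    have hAint : Integrable ((Y ⁻¹' A).indicator fun _ => (1 : ℝ)) μ :=
      (integrable_const _).indicator hYA
    have e1 : ∫ ω in F, (p * (Y ⁻¹' A).indicator fun _ => (1 : ℝ)) ω ∂μ
        = μ.real (Y ⁻¹' A ∩ (F ∩ B)) := by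
      have hI : Integrable (p * (Y ⁻¹' A).indicator fun _ => (1 : ℝ)) μ :=
        hAint.bdd_mul (c := 1) (hpm.mono hm).aestronglyMeasurable hp1
      rw [← setIntegral_condExp hm hI hF]
      -- The factor `p` is `m`-measurable and can be pulled out; conditional independence then
      -- recognises the product.
      have : μ[p * (Y ⁻¹' A).indicator fun _ => (1 : ℝ) | m] =ᵐ[μ] μ⟦B ∩ Y ⁻¹' A | m⟧ :=
        (condExp_stronglyMeasurable_mul_of_bound hm hpm hAint 1 hp1).trans (h x A hA).symm
      rw [setIntegral_congr_ae hF' (this.mono fun ω hω _ => hω),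
        setIntegral_condExp hm ((integrable_const _).indicator (hX.inter hYA)) hF,
        setIntegral_indicator (hX.inter hYA), setIntegral_const]
      simp only [smul_eq_mul, mul_one]
      congr 1
      ext; simp only [Set.mem_inter_iff]; tauto
    have e2 : (p * (Y ⁻¹' A).indicator fun _ => (1 : ℝ)) = (Y ⁻¹' A).indicator p := by
      ext ω; by_cases hω : ω ∈ Y ⁻¹' A <;> simp [Set.indicator, hω]
    rw [e2, setIntegral_indicator hYA] at e1
    rw [← ofReal_measureReal, ← e1, Set.inter_comm F,
      ofReal_integral_eq_lintegral_ofReal hpi.integrableOn (ae_restrict_of_ae hp0)]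
    rfl
  -- Conditional independence speaks of events only; equality of the two image measures carries it
  -- to the possibly unbounded `Y`.
  have e3 : ∫ ω in F, B.indicator Y ω ∂μ = ∫ ω in F, (p * Y) ω ∂μ := by
    rw [setIntegral_indicator hX]
    have : ∫ y, y ∂((μ.restrict (F ∩ B)).map Y) = ∫ y, y ∂(((μ.restrict F).withDensity
        fun ω => ((p ω).toNNReal : ENNReal)).map Y) := by rw [hmap]
    rw [integral_map hY.aemeasurable (by fun_prop), integral_map hY.aemeasurable (by fun_prop),
      integral_withDensity_eq_integral_smul hpn] at this
    rw [this]
    refine integral_congr_ae (ae_restrict_of_ae ?_)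
    filter_upwards [hp0] with ω hω
    simp [NNReal.smul_def, Real.coe_toNNReal _ hω]
  have hI : Integrable (p * Y) μ := hint.bdd_mul (c := 1) (hpm.mono hm).aestronglyMeasurable hp1
  rw [e3, ← setIntegral_condExp hm hI hF]
  refine (setIntegral_congr_ae hF' ?_)
  filter_upwards [condExp_stronglyMeasurable_mul_of_bound hm hpm hint 1 hp1, h0] with ω h1 h2 _
  rw [h1]; simp [h2]

/-! ### Convergence of martingale difference series -/

section MartingaleDifferences

variable {Ω : Type*} {mΩ : MeasurableSpace Ω} {μ : Measure Ω} [IsProbabilityMeasure μ]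
  {ℱ : Filtration ℕ mΩ} {ξ β : ℕ → Ω → ℝ}

/-- A series of bounded martingale differences converges almost surely if the partial sums of
their squares are bounded. -/
theorem ae_exists_tendsto_sum_of_sum_sq_le {B c : ℝ}
    (hξ : ∀ n, StronglyMeasurable[ℱ (n + 1)] (ξ n))
    (hξ0 : ∀ n, μ[ξ n | ℱ n] =ᵐ[μ] 0) (hξB : ∀ n, ∀ᵐ ω ∂μ, |ξ n ω| ≤ B)
    (hc : ∀ N, ∀ᵐ ω ∂μ, ∑ n ∈ Finset.range N, ξ n ω ^ 2 ≤ c) :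
    ∀ᵐ ω ∂μ, ∃ l, Tendsto (fun N => ∑ n ∈ Finset.range N, ξ n ω) atTop (𝓝 l) := by
  set M : ℕ → Ω → ℝ := fun N ω => ∑ n ∈ Finset.range N, ξ n ω with hM
  have hξi : ∀ n, Integrable (ξ n) μ := fun n =>
    Integrable.of_bound ((hξ n).mono (ℱ.le _)).aestronglyMeasurable B (hξB n)
  have hadp : StronglyAdapted ℱ M := fun N =>
    Finset.stronglyMeasurable_fun_sum _ fun n hn =>
      (hξ n).mono (ℱ.mono (Nat.succ_le_of_lt (Finset.mem_range.1 hn)))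
  have hMi : ∀ N, Integrable (M N) μ := fun N => integrable_finsetSum _ fun n _ => hξi n
  have hMB : ∀ N, ∀ᵐ ω ∂μ, ‖M N ω‖ ≤ N * B := by
    intro N
    filter_upwards [ae_all_iff.2 hξB] with ω hω
    refine (Finset.abs_sum_le_sum_abs _ _).trans ?_
    refine (Finset.sum_le_sum fun n _ => hω n).trans ?_
    simp
  have hmart : Martingale M ℱ μ := by
    refine martingale_of_condExp_sub_eq_zero_nat hadp hMi fun n => ?_
    have : M (n + 1) - M n = ξ n := by
      ext ω; simp [hM, Finset.sum_range_succ]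
    rw [this]; exact hξ0 n
  have hsqi : ∀ n, Integrable (fun ω => ξ n ω ^ 2) μ := fun n => by
    simp only [pow_two]
    exact (hξi n).bdd_mul (c := B) (hξi n).aestronglyMeasurable (hξB n)
  have hMsqi : ∀ N, Integrable (fun ω => M N ω ^ 2) μ := fun n => by
    simp only [pow_two]
    exact (hMi n).bdd_mul (c := n * B) (hMi n).aestronglyMeasurable (hMB n)
  have hcross : ∀ N, Integrable (M N * ξ N) μ := fun N =>
    (hξi N).bdd_mul (c := N * B) (hMi N).aestronglyMeasurable (hMB N)
  have hcross0 : ∀ N, ∫ ω, (M N * ξ N) ω ∂μ = 0 := by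
    intro N
    rw [← integral_condExp (ℱ.le N)]
    refine integral_eq_zero_of_ae ?_
    filter_upwards [condExp_mul_of_stronglyMeasurable_left (hadp N) (hcross N) (hξi N), hξ0 N]
      with ω h1 h2
    rw [h1]; simp [h2]
  -- Orthogonality of the increments turns the pathwise bound on squares into a uniform second
  -- moment bound.
  have hsq : ∀ N, ∫ ω, M N ω ^ 2 ∂μ = ∫ ω, ∑ n ∈ Finset.range N, ξ n ω ^ 2 ∂μ := by
    intro N
    induction N with
    | zero => simp [hM]
    | succ N ih =>
      have e1 : (fun ω => M (N + 1) ω ^ 2) =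
          fun ω => (M N ω ^ 2 + 2 * (M N * ξ N) ω) + ξ N ω ^ 2 := by
        ext ω
        simp only [hM, Finset.sum_range_succ, Pi.mul_apply]; ring
      simp only [Finset.sum_range_succ]
      rw [e1, integral_add (f := fun ω => M N ω ^ 2 + 2 * (M N * ξ N) ω)
        ((hMsqi N).add ((hcross N).const_mul 2)) (hsqi N), integral_add (hMsqi N) ((hcross N).const_mul 2), integral_const_mul, hcross0, ih,
        integral_add (integrable_finsetSum _ fun n _ => hsqi n) (hsqi N)]
      ring
  have hL1 : ∀ N, eLpNorm (M N) 1 μ ≤ ((1 + c).toNNReal : ENNReal) := by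
    intro N
    rw [eLpNorm_one_eq_lintegral_enorm, ← ofReal_integral_norm_eq_lintegral_enorm (hMi N)]
    refine ENNReal.ofReal_le_ofReal ?_
    -- Since `|x| ≤ 1 + x ^ 2`, the second moment bound yields the L¹ bound required by the
    -- martingale convergence theorem.
    calc ∫ ω, ‖M N ω‖ ∂μ ≤ ∫ ω, (1 + M N ω ^ 2) ∂μ := by
          refine integral_mono (hMi N).norm ((integrable_const _).add (hMsqi N)) fun ω => ?_
          simp only [Real.norm_eq_abs]
          nlinarith [sq_abs (M N ω), sq_nonneg (|M N ω| - 1)]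
      _ = 1 + ∫ ω, ∑ n ∈ Finset.range N, ξ n ω ^ 2 ∂μ := by
          rw [integral_add (integrable_const _) (hMsqi N), hsq]; simp
      _ ≤ 1 + ∫ _, c ∂μ := by
          exact add_le_add le_rfl (integral_mono_ae (integrable_finsetSum _ fun n _ => hsqi n)
            (integrable_const _) (hc N))
      _ = 1 + c := by simp
  filter_upwards [hmart.submartingale.ae_tendsto_limitProcess hL1] with ω hω
  exact ⟨_, hω⟩

/-- A series of bounded martingale differences converges almost surely if it is dominated by a
bounded adapted sequence that is almost surely square summable. -/
theorem ae_exists_tendsto_sum_of_summable_sq {B : ℝ}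
    (hξ : ∀ n, StronglyMeasurable[ℱ (n + 1)] (ξ n))
    (hξ0 : ∀ n, μ[ξ n | ℱ n] =ᵐ[μ] 0) (hβ : ∀ n, Measurable[ℱ (n + 1)] (β n))
    (hβ0 : ∀ n ω, 0 ≤ β n ω) (hβB : ∀ n ω, β n ω ≤ B)
    (hξβ : ∀ n, ∀ᵐ ω ∂μ, |ξ n ω| ≤ β n ω)
    (hsum : ∀ᵐ ω ∂μ, Summable fun n => β n ω ^ 2) :
    ∀ᵐ ω ∂μ, ∃ l, Tendsto (fun N => ∑ n ∈ Finset.range N, ξ n ω) atTop (𝓝 l) := by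
  -- Stopping in predictable form: `G c n` involves only `β k` with `k < n`, hence is known at time
  -- `n`, and truncation to it preserves martingale differences.
  let G : ℕ → ℕ → Set Ω := fun c n => {ω | ∑ k ∈ Finset.range n, β k ω ^ 2 ≤ c}
  have hG : ∀ c n, MeasurableSet[ℱ n] (G c n) := fun c n =>
    measurableSet_le (Finset.measurable_fun_sum _ fun k hk =>
      ((hβ k).mono (ℱ.mono (Nat.succ_le_of_lt (Finset.mem_range.1 hk))) le_rfl).pow_const 2)
      measurable_const
  have hξi : ∀ n, Integrable (ξ n) μ := fun n =>
    Integrable.of_bound ((hξ n).mono (ℱ.le _)).aestronglyMeasurable B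
      ((hξβ n).mono fun ω hω => hω.trans (hβB n ω))
  have main : ∀ c : ℕ, ∀ᵐ ω ∂μ, ∃ l,
      Tendsto (fun N => ∑ n ∈ Finset.range N, (G c n).indicator (ξ n) ω) atTop (𝓝 l) := by
    intro c
    -- The last term admitted can overshoot `c` by at most `B ^ 2`.
    refine ae_exists_tendsto_sum_of_sum_sq_le (B := B) (c := c + B ^ 2)
      (fun n => (hξ n).indicator (ℱ.mono n.le_succ _ (hG c n))) (fun n => ?_) (fun n => ?_)
      (fun N => ?_)
    · filter_upwards [condExp_indicator (hξi n) (hG c n), hξ0 n] with ω h1 h2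
      rw [h1]; by_cases h : ω ∈ G c n <;> simp [h, h2]
    · filter_upwards [hξβ n] with ω h
      by_cases hω : ω ∈ G c n
      · simpa [hω] using h.trans (hβB n ω)
      · simpa [hω] using (hβ0 n ω).trans (hβB n ω)
    · filter_upwards [ae_all_iff.2 hξβ] with ω h
      have hB : 0 ≤ B := (hβ0 0 ω).trans (hβB 0 ω)
      have hsqle : ∀ n, ξ n ω ^ 2 ≤ β n ω ^ 2 := fun n =>
        sq_le_sq.2 ((h n).trans (le_abs_self _))
      -- The comparison with the sum of `β n ω ^ 2` is carried along because on `G c N` it bounds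
      -- the earlier terms by `c`.
      have hcase : ∀ N, ∑ n ∈ Finset.range N, (G c n).indicator (ξ n) ω ^ 2 ≤
          min (∑ n ∈ Finset.range N, β n ω ^ 2) (c + B ^ 2) := by
        intro N
        induction N with
        | zero => simp; positivity
        | succ N ih =>
          rw [Finset.sum_range_succ, Finset.sum_range_succ]
          obtain ⟨ih1, ih2⟩ := le_min_iff.1 ih
          by_cases hω : ω ∈ G c N
          · have hω' : ∑ k ∈ Finset.range N, β k ω ^ 2 ≤ c := hω
            have h3 : β N ω ^ 2 ≤ B ^ 2 := pow_le_pow_left₀ (hβ0 N ω) (hβB N ω) 2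
            have := hsqle N
            simp only [Set.indicator_of_mem hω]
            refine le_min ?_ ?_ <;> linarith
          · simp only [Set.indicator_of_notMem hω]
            have := sq_nonneg (β N ω)
            refine le_min ?_ ?_ <;> linarith
      exact (hcase N).trans (min_le_right _ _)
  filter_upwards [ae_all_iff.2 main, hsum] with ω h hs
  -- Once `c` exceeds the whole sum, nothing is truncated on this path.
  obtain ⟨c, hc⟩ := exists_nat_ge (∑' n, β n ω ^ 2)
  obtain ⟨l, hl⟩ := h c
  refine ⟨l, hl.congr fun N => Finset.sum_congr rfl fun n _ => Set.indicator_of_mem ?_ _⟩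
  exact (hs.sum_le_tsum _ fun _ _ => sq_nonneg _).trans hc

end MartingaleDifferences

/-! ### The order on states and the monotonicity operator -/

namespace Bidding

namespace State

variable {Rmax Lmax : ℕ} {bids : Finset (ℝ × ℝ)} {PS : Type*}

instance [Finite PS] : Finite (State Rmax Lmax bids PS) :=
  Finite.of_injective (fun s => (s.r, s.l, s.b, s.p)) fun s s' h => by
    simp only [Prod.mk.injEq] at h
    exact State.ext h.1 h.2.1 h.2.2.1 h.2.2.2

instance : DiscreteMeasurableSpace (State Rmax Lmax bids PS) := ⟨fun _ => trivial⟩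

theorem Below.trans {s s' s'' : State Rmax Lmax bids PS} (h : s.Below s') (h' : s'.Below s'') :
    s.Below s'' :=
  ⟨h.1.trans h'.1, h.2.1.trans h'.2.1, h.2.2.1.trans h'.2.2.1, h.2.2.2.1.trans h'.2.2.2.1,
    h.2.2.2.2.trans h'.2.2.2.2⟩

theorem Below.antisymm {s s' : State Rmax Lmax bids PS} (h : s.Below s') (h' : s'.Below s) :
    s = s' :=
  State.ext (h.1.antisymm h'.1) (h.2.1.antisymm h'.2.1)
    (Subtype.ext (Prod.ext (h.2.2.1.antisymm h'.2.2.1) (h.2.2.2.1.antisymm h'.2.2.2.1)))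
    h.2.2.2.2

/-- The strict order on states. -/
def StrictlyBelow (s s' : State Rmax Lmax bids PS) : Prop := s.Below s' ∧ s ≠ s'

theorem StrictlyBelow.trans {s s' s'' : State Rmax Lmax bids PS} (h : s.StrictlyBelow s')
    (h' : s'.StrictlyBelow s'') : s.StrictlyBelow s'' :=
  ⟨h.1.trans h'.1, fun he => h.2 (h.1.antisymm (he ▸ h'.1))⟩

theorem project_self (S : State Rmax Lmax bids PS) (z v : ℝ) : project S z S v = z := by
  simp [project]

theorem project_of_ne {S s : State Rmax Lmax bids PS} (hs : S ≠ s) (z v : ℝ) :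
    project S z s v = v ∨ S.StrictlyBelow s ∧ project S z s v = max z v ∨
      s.StrictlyBelow S ∧ project S z s v = min z v := by
  unfold project
  rw [if_neg hs.symm]
  split_ifs with h1 h2
  · exact Or.inr (Or.inl ⟨⟨h1, hs⟩, rfl⟩)
  · exact Or.inr (Or.inr ⟨⟨h2, hs.symm⟩, rfl⟩)
  · exact Or.inl rfl

theorem abs_project_le {S s : State Rmax Lmax bids PS} {z v B : ℝ} (hz : |z| ≤ B)
    (hv : |v| ≤ B) : |project S z s v| ≤ B := by
  unfold project
  split_ifs
  · exact hz
  · exact abs_max_le_max_abs_abs.trans (max_le hz hv)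
  · exact abs_min_le_max_abs_abs.trans (max_le hz hv)
  · exact hv

end State

/-! ### Monotonicity of transitions and revenue -/

namespace Model

variable {PS : Type*} [MeasurableSpace PS] (D : Model PS)

instance (t : ℕ) (p : PS) : IsProbabilityMeasure (D.law t p) := D.law_prob t p

/-- Higher bids make discharging rarer and charging more frequent, which is why a higher previous
bid leaves at least as much energy. -/
theorem q_anti {b b' : D.bids} (h1 : b.1.1 ≤ b'.1.1) (h2 : b.1.2 ≤ b'.1.2) (P : Fin D.M → ℝ)
    (m : Fin D.M) : D.q P b' m ≤ D.q P b m := by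
  unfold q
  have e1 : (if b'.1.2 < P m then (1 : ℤ) else 0) ≤ if b.1.2 < P m then 1 else 0 := by
    split_ifs with h h'
    · exact le_rfl
    · exact absurd (h2.trans_lt h) h'
    · exact zero_le_one
    · exact le_rfl
  have e2 : (if P m < b.1.1 then (1 : ℤ) else 0) ≤ if P m < b'.1.1 then 1 else 0 := by
    split_ifs with h h'
    · exact le_rfl
    · exact absurd (h.trans_le h1) h'
    · exact zero_le_one
    · exact le_rfl
  omega

theorem d_anti {b b' : D.bids} (h2 : b.1.2 ≤ b'.1.2) (P : Fin D.M → ℝ)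
    (m : Fin D.M) : D.d P b' m ≤ D.d P b m := by
  unfold d
  split_ifs with h h'
  · exact le_rfl
  · exact absurd (h2.trans_lt h) h'
  · exact zero_le_one
  · exact le_rfl

theorem stepR_mono {r r' : Fin (D.Rmax + 1)} (h : r ≤ r') {x x' : ℤ} (hx : x' ≤ x) :
    D.stepR r x ≤ D.stepR r' x' := by
  have : (r : ℕ) ≤ r' := h
  simp only [stepR, Fin.mk_le_mk]
  omega

theorem stepL_mono {l l' : Fin (D.Lmax + 1)} (h : l ≤ l') {x x' : ℤ} (hx : x' ≤ x) :
    D.stepL l x ≤ D.stepL l' x' := by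
  have : (l : ℕ) ≤ l' := h
  simp only [stepL, Fin.mk_le_mk]
  omega

theorem gR_mono {r r' : Fin (D.Rmax + 1)} (h : r ≤ r') {x x' : Fin D.M → ℤ}
    (hx : ∀ m, x' m ≤ x m) (m : ℕ) : D.gR r x m ≤ D.gR r' x' m := by
  induction m with
  | zero => exact h
  | succ m ih =>
    simp only [gR]
    split_ifs
    · exact D.stepR_mono ih (hx _)
    · exact ih

theorem gL_mono {l l' : Fin (D.Lmax + 1)} (h : l ≤ l') {x x' : Fin D.M → ℤ}
    (hx : ∀ m, x' m ≤ x m) (m : ℕ) : D.gL l x m ≤ D.gL l' x' m := by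
  induction m with
  | zero => exact h
  | succ m ih =>
    simp only [gL]
    split_ifs
    · exact D.stepL_mono ih (hx _)
    · exact ih

/-- The revenue of one settlement is nondecreasing in the energy level and the lifetime. -/
theorem settlement_mono {r r' : Fin (D.Rmax + 1)} (hr : r ≤ r') {l l' : Fin (D.Lmax + 1)}
    (hl : l ≤ l') {x : ℝ} (hx : 0 ≤ x) (q : ℤ) :
    D.γ r l q * x * (q : ℝ) * D.U r q ≤ D.γ r' l' q * x * (q : ℝ) * D.U r' q := by
  by_cases hq : q = 1
  · subst hq
    have hK := D.K_nonneg
    -- Only an obligation to sell depends on level and lifetime. Passing from empty to nonempty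
    -- replaces `-K * x` by a nonnegative amount; between nonempty levels only the factor `β` grows.
    have hβ := D.β_mono hl
    have h0 := (D.β_mem l').1
    by_cases h : r = 0
    · by_cases h' : r' = 0
      · simp [γ, U, h, h']
      · have h1 := mul_nonneg h0 hx
        have h2 := mul_nonneg hK hx
        simp [γ, U, h, h']
        linarith
    · have h' : r' ≠ 0 := fun h' => h (Fin.le_zero_iff.1 (h' ▸ hr))
      simp only [γ, U, h, h', if_false, ne_eq, not_false_eq_true, and_self, if_true, Int.cast_one,
        mul_one, mul_zero, sub_zero]
      exact mul_le_mul_of_nonneg_right hβ hx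
  · simp [γ, U, hq]

theorem revenue_mono {r r' : Fin (D.Rmax + 1)} (hr : r ≤ r') {l l' : Fin (D.Lmax + 1)}
    (hl : l ≤ l') {P : Fin D.M → ℝ} (hP : ∀ m, 0 ≤ P m) (b : D.bids) :
    D.revenue r l P b ≤ D.revenue r' l' P b :=
  Finset.sum_le_sum fun m _ => D.settlement_mono (D.gR_mono hr (fun _ => le_rfl) _)
    (D.gL_mono hl (fun _ => le_rfl) _) (hP m) _

theorem nextR_mono {s s' : D.S} (h : s.Below s') (P : Fin D.M → ℝ) :
    D.nextR s.r P s.b ≤ D.nextR s'.r P s'.b :=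
  D.gR_mono h.1 (D.q_anti h.2.2.1 h.2.2.2.1 P) _

theorem nextL_mono {s s' : D.S} (h : s.Below s') (P : Fin D.M → ℝ) :
    D.nextL s.l P s.b ≤ D.nextL s'.l P s'.b :=
  D.gL_mono h.2.1 (D.d_anti h.2.2.2.1 P) _

theorem transition_mono {s s' : D.S} (h : s.Below s') (b : D.bids) (P : Fin D.M → ℝ) (p : PS) :
    (D.transition s b P p).Below (D.transition s' b P p) :=
  ⟨D.nextR_mono h P, D.nextL_mono h P, le_rfl, le_rfl, rfl⟩

/-! ### Measurability, continuity and monotonicity of the Bellman operator -/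

theorem measurable_q (b : D.bids) (m : Fin D.M) : Measurable fun P => D.q P b m := by
  unfold q
  refine Measurable.sub ?_ ?_
  · exact Measurable.ite (measurableSet_lt measurable_const (measurable_pi_apply m))
      measurable_const measurable_const
  · exact Measurable.ite (measurableSet_lt (measurable_pi_apply m) measurable_const)
      measurable_const measurable_const

theorem measurable_d (b : D.bids) (m : Fin D.M) : Measurable fun P => D.d P b m := by
  unfold d
  exact Measurable.ite (measurableSet_lt measurable_const (measurable_pi_apply m))
    measurable_const measurable_const

theorem measurable_nextR (r : Fin (D.Rmax + 1)) (b : D.bids) :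
    Measurable fun P => D.nextR r P b := by
  have : ∀ m, Measurable fun P => D.gR r (D.q P b) m := by
    intro m
    induction m with
    | zero => exact measurable_const
    | succ m ih =>
      simp only [gR]
      split_ifs with h
      · have hstep : Measurable fun x : Fin (D.Rmax + 1) × ℤ => D.stepR x.1 x.2 :=
          Measurable.of_discrete
        have hpair := ih.prodMk (D.measurable_q b ⟨m, h⟩)
        have hcomp := hstep.comp hpair
        exact hcomp
      · exact ih
  exact this _

theorem measurable_nextL (l : Fin (D.Lmax + 1)) (b : D.bids) :
    Measurable fun P => D.nextL l P b := by
  have : ∀ m, Measurable fun P => D.gL l (D.d P b) m := by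
    intro m
    induction m with
    | zero => exact measurable_const
    | succ m ih =>
      simp only [gL]
      split_ifs with h
      · have hstep : Measurable fun x : Fin (D.Lmax + 1) × ℤ => D.stepL x.1 x.2 :=
          Measurable.of_discrete
        have hpair := ih.prodMk (D.measurable_d b ⟨m, h⟩)
        have hcomp := hstep.comp hpair
        exact hcomp
      · exact ih
  exact this _

theorem optimalValue_of_lt {t : ℕ} (ht : t < D.T) :
    D.optimalValue t = D.bellman t (D.optimalValue (t + 1)) := by
  rw [optimalValue, dif_pos ht]

theorem optimalValue_of_ge {t : ℕ} (ht : ¬ t < D.T) : D.optimalValue t = D.Cterm := by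
  rw [optimalValue, dif_neg ht]

theorem abs_expectedNext_le {t : ℕ} {V : D.S → ℝ} {B : ℝ} (hV : ∀ s, |V s| ≤ B) (s : D.S)
    (b : D.bids) : |D.expectedNext t V s b| ≤ B := by
  have := norm_integral_le_of_norm_le_const (μ := D.law t s.p)
    (f := fun x => V (D.transition s b x.1 x.2.2)) (Eventually.of_forall fun x => hV _)
  simpa [expectedNext] using this

variable [Finite PS]

/-- The bound is uniform in `V`, so it applies to the random estimates and yields a deterministic
bound on the noise in a bounded observation. Finitely many contributions occur. -/
theorem exists_abs_bellman_le (t : ℕ) (B : ℝ) :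
    ∃ C, ∀ V : D.S → ℝ, (∀ s, |V s| ≤ B) → ∀ s, |D.bellman t V s| ≤ C := by
  obtain ⟨C, hC⟩ := (Set.finite_range fun y : D.S × D.bids => |D.contribution t y.1 y.2|).bddAbove
  refine ⟨C + B, fun V hV s => ?_⟩
  have hb : ∀ b : D.bids, |D.contribution t s b + D.expectedNext t V s b| ≤ C + B := fun b =>
    (abs_add_le _ _).trans (add_le_add (hC ⟨(s, b), rfl⟩) (D.abs_expectedNext_le hV s b))
  obtain ⟨b, _, h⟩ := Finset.exists_mem_eq_sup' (s := Finset.univ) ⟨s.b, Finset.mem_univ _⟩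
    (fun b : D.bids => D.contribution t s b + D.expectedNext t V s b)
  rw [bellman, h]
  exact hb b

variable [MeasurableSingletonClass PS]

theorem measurable_transition (s : D.S) (b : D.bids) :
    Measurable fun x : (Fin D.M → ℝ) × (Fin D.M → ℝ) × PS => D.transition s b x.1 x.2.2 :=
  (Measurable.of_discrete
    (f := fun y : (Fin (D.Rmax + 1) × Fin (D.Lmax + 1)) × PS => (⟨y.1.1, y.1.2, b, y.2⟩ : D.S))).comp
    ((((D.measurable_nextR s.r s.b).comp measurable_fst).prodMk
      ((D.measurable_nextL s.l s.b).comp measurable_fst)).prodMk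
      (measurable_snd.comp measurable_snd))

theorem integrable_transition (t : ℕ) (V : D.S → ℝ) (s : D.S) (b : D.bids) :
    Integrable (fun x => V (D.transition s b x.1 x.2.2)) (D.law t s.p) :=
  (Integrable.of_finite (f := V)).comp_measurable (D.measurable_transition s b)

/-- On a finite state space the expectation is a finite linear combination with fixed transition
probabilities, so pointwise convergence suffices. -/
theorem tendsto_expectedNext {V : ℕ → D.S → ℝ} {v : D.S → ℝ}
    (hV : ∀ s, Tendsto (fun n => V n s) atTop (𝓝 (v s))) (t : ℕ) (s : D.S) (b : D.bids) :
    Tendsto (fun n => D.expectedNext t (V n) s b) atTop (𝓝 (D.expectedNext t v s b)) := by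
  have := Fintype.ofFinite D.S
  have key : ∀ V : D.S → ℝ, D.expectedNext t V s b = ∑ s' : D.S,
      ((D.law t s.p).map fun x => D.transition s b x.1 x.2.2).real {s'} • V s' := fun V => by
    rw [← integral_fintype Integrable.of_finite,
      integral_map (D.measurable_transition s b).aemeasurable
        (Measurable.of_discrete.aestronglyMeasurable)]
    rfl
  simp only [key]
  exact tendsto_finsetSum _ fun s' _ => (hV s').const_smul _

theorem tendsto_bellman {V : ℕ → D.S → ℝ} {v : D.S → ℝ}
    (hV : ∀ s, Tendsto (fun n => V n s) atTop (𝓝 (v s))) (t : ℕ) (s : D.S) :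
    Tendsto (fun n => D.bellman t (V n) s) atTop (𝓝 (D.bellman t v s)) := by
  have := Tendsto.finset_sup'_nhds (l := atTop) (s := Finset.univ) ⟨s.b, Finset.mem_univ _⟩
    (f := fun (b : D.bids) n => D.contribution t s b + D.expectedNext t (V n) s b)
    fun b _ => (D.tendsto_expectedNext hV t s b).const_add (D.contribution t s b)
  refine this.congr fun n => ?_
  exact Finset.sup'_apply _ _ _

/-- Every bid is available in every state, so both states can be compared under the same bid;
comparable states share the price state and hence the price law. -/
theorem bellman_mono {t : ℕ}
    (hC : ∀ (s : D.S) (b : D.bids),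
      Integrable (fun x => D.nextRevenue s b x.1 x.2.1) (D.law t s.p))
    {V : D.S → ℝ} (hV : ∀ s s', s.Below s' → V s ≤ V s') {s s' : D.S} (h : s.Below s') :
    D.bellman t V s ≤ D.bellman t V s' := by
  refine Finset.sup'_le _ _ fun b _ => le_trans ?_
    (Finset.le_sup' (fun b : D.bids => D.contribution t s' b + D.expectedNext t V s' b)
      (Finset.mem_univ b))
  have hp := h.2.2.2.2
  have i1 := hC s b
  have i2 := D.integrable_transition t V s b
  unfold contribution expectedNext
  rw [hp] at i1 i2 ⊢
  refine add_le_add (integral_mono_ae i1 (hC s' b) ?_)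
    (integral_mono i2 (D.integrable_transition t V s' b) fun x => hV _ _ (D.transition_mono h b _ _))
  filter_upwards [D.law_nonneg t s'.p] with x hx
  exact D.revenue_mono (D.nextR_mono h _) (D.nextL_mono h _) hx.2 b

theorem optimalValue_mono (hC : ∀ t < D.T, ∀ (s : D.S) (b : D.bids),
      Integrable (fun x => D.nextRevenue s b x.1 x.2.1) (D.law t s.p)) :
    ∀ k t, D.T ≤ t + k → ∀ s s', s.Below s' → D.optimalValue t s ≤ D.optimalValue t s' := by
  intro k
  induction k with
  | zero =>
    intro t ht s s' h
    rw [D.optimalValue_of_ge (by omega)]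
    exact D.Cterm_mono s s' h
  | succ k ih =>
    intro t ht s s' h
    by_cases htT : t < D.T
    · rw [D.optimalValue_of_lt htT]
      exact D.bellman_mono (hC t htT) (ih (t + 1) (by omega)) h
    · rw [D.optimalValue_of_ge htT]
      exact D.Cterm_mono s s' h

end Model

end Bidding

/-! ### The algorithm along one run, and its history -/

namespace Bidding

namespace Model

variable {PS : Type*} [MeasurableSpace PS] {D : Model PS}

section Estimate

variable {X : ℕ → ℕ → D.S} {w : ℕ → ℕ → D.S → ℝ} {a : ℕ → ℕ → ℝ}

theorem estimate_of_ge {t : ℕ} (ht : ¬ t < D.T) (n : ℕ) (s : D.S) :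
    D.estimate X w a n t s = D.Cterm s := by
  cases n <;> simp [estimate, ht]

theorem estimate_succ {t : ℕ} (ht : t < D.T) (n : ℕ) (s : D.S) :
    D.estimate X w a (n + 1) t s = State.project (X (n + 1) t)
      ((1 - a n t) * D.estimate X w a n t (X (n + 1) t) + a n t *
        D.observe t (D.estimate X w a n (t + 1)) (X (n + 1) t) (w (n + 1) t (X (n + 1) t))) s
      (D.estimate X w a n t s) := by
  rw [estimate, if_pos ht]

theorem abs_estimate_le {B : ℝ} (hB : 0 ≤ B) (hC : ∀ s, |D.Cterm s| ≤ B)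
    (ha : ∀ n, ∀ t < D.T, a n t ∈ Set.Icc (0 : ℝ) 1)
    (hobs : ∀ n, ∀ t < D.T, |D.observe t (D.estimate X w a n (t + 1)) (X (n + 1) t)
      (w (n + 1) t (X (n + 1) t))| ≤ B) (n t : ℕ) (s : D.S) :
    |D.estimate X w a n t s| ≤ B := by
  by_cases ht : t < D.T
  · induction n generalizing s with
    | zero => simpa [estimate, ht] using hB
    | succ n ih =>
      rw [estimate_succ ht]
      refine State.abs_project_le ?_ (ih s)
      obtain ⟨h0, h1⟩ := ha n t ht
      refine (abs_add_le _ _).trans ?_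
      rw [abs_mul, abs_mul, abs_of_nonneg h0, abs_of_nonneg (sub_nonneg.2 h1)]
      have e1 := mul_le_mul_of_nonneg_left (ih (X (n + 1) t)) (sub_nonneg.2 h1)
      have e2 := mul_le_mul_of_nonneg_left (hobs n t ht) h0
      linarith
  · rw [estimate_of_ge ht]; exact hC s

/-- Convergence of the estimates along one run on which the accumulated noise converges. -/
theorem tendsto_estimate [Finite PS] [MeasurableSingletonClass PS]
    (hC : ∀ t < D.T, ∀ (s : D.S) (b : D.bids),
      Integrable (fun x => D.nextRevenue s b x.1 x.2.1) (D.law t s.p))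
    (ha : ∀ n, ∀ t < D.T, a n t ∈ Set.Icc (0 : ℝ) 1)
    {α ξ : ℕ → D.S → ℕ → ℝ}
    (hα : ∀ t s n, X (n + 1) t = s → α t s n = a n t)
    (hα0 : ∀ t s n, X (n + 1) t ≠ s → α t s n = 0)
    (hξ : ∀ t s n, X (n + 1) t = s → ξ t s n = a n t * w (n + 1) t s)
    (hξ0 : ∀ t s n, X (n + 1) t ≠ s → ξ t s n = 0)
    (hsum : ∀ t < D.T, ∀ s, Tendsto (fun N => ∑ n ∈ Finset.range N, α t s n) atTop atTop)
    (hconv : ∀ t < D.T, ∀ s, ∃ c, Tendsto (fun N => ∑ n ∈ Finset.range N, ξ t s n) atTop (𝓝 c))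
    (k t : ℕ) (htk : D.T ≤ t + k) (s : D.S) :
    Tendsto (fun n => D.estimate X w a n t s) atTop (𝓝 (D.optimalValue t s)) := by
  induction k generalizing t s with
  | zero =>
    simp only [estimate_of_ge (show ¬ t < D.T by omega)]
    rw [D.optimalValue_of_ge (by omega)]
    exact tendsto_const_nhds
  | succ k ih =>
    by_cases ht : t < D.T
    swap
    · simp only [estimate_of_ge ht]
      rw [D.optimalValue_of_ge ht]
      exact tendsto_const_nhds
    have hnext := ih (t + 1) (by omega)
    refine stochasticApproximation_tendsto (lt := State.StrictlyBelow)
      (V := fun n => D.estimate X w a n t) (X := fun n => X (n + 1) t) (α := α t) (ξ := ξ t)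
      -- The bias is the Bellman error caused by using the current estimates at `t + 1`; it vanishes
      -- by the induction hypothesis.
      (ε := fun s n => D.bellman t (D.estimate X w a n (t + 1)) s - D.optimalValue t s)
      (fun _ _ _ h h' => h.trans h') (fun s h => h.2 rfl)
      (fun s s' h => D.optimalValue_mono hC (k + 1) t htk s s' h.1)
      (fun s n => ?_) (hα0 t) (hξ0 t) (hsum t ht) (hconv t ht) (fun s => ?_)
      (fun s n h => ?_) (fun s n h => ?_) s
    · by_cases h : X (n + 1) t = s
      · rw [hα t s n h]; exact ha n t ht
      · rw [hα0 t s n h]; exact ⟨le_rfl, zero_le_one⟩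
    · have := (D.tendsto_bellman hnext t s).sub_const (D.optimalValue t s)
      rwa [D.optimalValue_of_lt ht, sub_self, ← D.optimalValue_of_lt ht] at this
    · simp only [estimate_succ ht]
      rw [hα t s n h, hξ t s n h, h, State.project_self, observe]
      ring
    -- The number `z` used for corrections is exactly the new estimate at the visited state.
    · simp only [estimate_succ ht, State.project_self]
      exact State.project_of_ne h _ _

end Estimate

section History

variable {Ω : Type*} {X : ℕ → ℕ → Ω → D.S} {w : ℕ → ℕ → D.S → Ω → ℝ}

theorem measurable_visited {n m t : ℕ} (hm : m ∈ Set.Icc 1 n) (ht : t ≤ D.T) :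
    Measurable[D.history X w n] (X m t) := by
  refine Measurable.mono (comap_measurable (X m t)) ?_ le_rfl
  exact (le_iSup₂_of_le (f := fun t (_ : t ∈ Set.Iic D.T) =>
      MeasurableSpace.comap (X m t) inferInstance) t ht le_rfl).trans
    (le_sup_left.trans (le_iSup₂_of_le (f := fun m (_ : m ∈ Set.Icc 1 n) => _) m hm le_rfl))

theorem measurable_noise_visited {n m t : ℕ} (hm : m ∈ Set.Icc 1 n) (ht : t < D.T) :
    Measurable[D.history X w n] (fun ω => w m t (X m t ω) ω) := by
  refine Measurable.mono (comap_measurable (fun ω => w m t (X m t ω) ω)) ?_ le_rfl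
  exact (le_iSup₂_of_le (f := fun t (_ : t ∈ Set.Iio D.T) =>
      MeasurableSpace.comap (fun ω => w m t (X m t ω) ω) inferInstance) t ht le_rfl).trans
    (le_sup_right.trans (le_iSup₂_of_le (f := fun m (_ : m ∈ Set.Icc 1 n) => _) m hm le_rfl))

theorem history_mono : Monotone (D.history X w) := fun _ _ h =>
  biSup_mono fun _ hm => ⟨hm.1, hm.2.trans h⟩

theorem history_le [Finite PS] {mΩ : MeasurableSpace Ω} (hX : ∀ n t, Measurable (X n t))
    (hw : ∀ n t s, Measurable (w n t s)) (n : ℕ) : D.history X w n ≤ mΩ := by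
  refine iSup₂_le fun m _ => sup_le (iSup₂_le fun t _ => (hX m t).comap_le)
    (iSup₂_le fun t _ => Measurable.comap_le ?_)
  -- Noise at a random state is measurable since the state ranges over a countable set.
  have h : Measurable fun p : D.S × Ω => w m t p.1 p.2 :=
    measurable_from_prod_countable_right fun s => hw m t s
  exact h.comp ((hX m t).prodMk measurable_id)

/-- The filtration generated by the runs of the algorithm. -/
def historyFiltration [Finite PS] {mΩ : MeasurableSpace Ω} (hX : ∀ n t, Measurable (X n t))
    (hw : ∀ n t s, Measurable (w n t s)) : Filtration ℕ mΩ where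
  seq := D.history X w
  mono' := history_mono
  le' := history_le hX hw

end History

end Model

end Bidding

/-! ### Almost sure convergence -/

theorem theorem1 {PS : Type*} [Finite PS] [MeasurableSpace PS] [MeasurableSingletonClass PS]
    (D : Bidding.Model PS)
    -- the expectation that defines the contribution function exists
    (hC : ∀ t < D.T, ∀ (s : D.S) (b : D.bids),
      Integrable (fun x => D.nextRevenue s b x.1 x.2.1) (D.law t s.p))
    {Ω : Type*} {mΩ : MeasurableSpace Ω} (μ : Measure Ω) [IsProbabilityMeasure μ]
    -- visited states `X n t = S_t^n`, noise `w n t s = w_t^n(s)`, stepsizes `a n t = α_t^n`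
    (X : ℕ → ℕ → Ω → D.S) (w : ℕ → ℕ → D.S → Ω → ℝ) (a : ℕ → ℕ → Ω → ℝ)
    (hX : ∀ n t, Measurable (X n t))
    (hw : ∀ n t s, Measurable (w n t s))
    -- the state visited in iteration `n + 1` is chosen given the history of the first `n`
    -- iterations: given that history, it does not depend on the noise still to be sampled there
    (hchoose : ∀ n, ∀ t < D.T, ∀ s,
      Bidding.CondIndepGiven μ (D.history X w n) (X (n + 1) t) (w (n + 1) t s))
    -- first assumption: every state is visited infinitely often
    (hvisit : ∀ t < D.T, ∀ s : D.S, ∀ᵐ ω ∂μ,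
      Tendsto (fun N => ∑ n ∈ Finset.range N, (μ⟦X (n + 1) t ⁻¹' {s} | D.history X w n⟧) ω)
        atTop atTop)
    -- second assumption: values and observations are bounded
    (Vmax : ℝ) (hVmax : 0 < Vmax)
    (hVbdd : ∀ t ≤ D.T, ∀ s, |D.optimalValue t s| ≤ Vmax)
    (hobs : ∀ n, ∀ t < D.T, ∀ᵐ ω ∂μ,
      |D.observe t
          (D.estimate (fun n t => X n t ω) (fun n t s => w n t s ω) (fun n t => a n t ω) n (t + 1))
          (X (n + 1) t ω) (w (n + 1) t (X (n + 1) t ω) ω)| ≤ Vmax)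
    -- third assumption: the noise is unbiased
    (hwint : ∀ n, ∀ t < D.T, ∀ s, Integrable (w (n + 1) t s) μ)
    (hnoise : ∀ n, ∀ t < D.T, ∀ s, μ[w (n + 1) t s | D.history X w n] =ᵐ[μ] 0)
    -- fourth assumption: stepsizes; `α_t^{n+1}(s) = α_t^n 1_{s = S_t^{n+1}}`
    (ha_mem : ∀ n, ∀ t < D.T, ∀ ω, a n t ω ∈ Set.Icc (0 : ℝ) 1)
    (ha_meas : ∀ n, ∀ t < D.T, Measurable[D.history X w n] (a n t))
    (ha_sum : ∀ t < D.T, ∀ s : D.S, ∀ᵐ ω ∂μ,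
      Tendsto (fun N => ∑ n ∈ Finset.range N, (X (n + 1) t ⁻¹' {s}).indicator (a n t) ω)
        atTop atTop)
    (ha_sq : ∀ t < D.T, ∀ s : D.S, ∀ᵐ ω ∂μ,
      Summable (fun n => ((X (n + 1) t ⁻¹' {s}).indicator (a n t) ω) ^ 2)) :
    ∀ t ≤ D.T, ∀ s : D.S, ∀ᵐ ω ∂μ,
      Tendsto
        (fun n => D.estimate (fun n t => X n t ω) (fun n t s => w n t s ω) (fun n t => a n t ω)
          n t s)
        atTop (𝓝 (D.optimalValue t s)) := by
  have hCterm : ∀ s, |D.Cterm s| ≤ Vmax := fun s => by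
    have := hVbdd D.T le_rfl s
    rwa [D.optimalValue_of_ge (lt_irrefl _)] at this
  have hobs' : ∀ᵐ ω ∂μ, ∀ n, ∀ t < D.T, |D.observe t
      (D.estimate (fun n t => X n t ω) (fun n t s => w n t s ω) (fun n t => a n t ω) n (t + 1))
      (X (n + 1) t ω) (w (n + 1) t (X (n + 1) t ω) ω)| ≤ Vmax :=
    ae_all_iff.2 fun n => ae_all_iff.2 fun t => ae_all_iff.2 fun ht => hobs n t ht
  have hnoise_sum : ∀ t < D.T, ∀ s : D.S, ∀ᵐ ω ∂μ, ∃ c, Tendsto (fun N => ∑ n ∈ Finset.range N,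
      a n t ω * (X (n + 1) t ⁻¹' {s}).indicator (w (n + 1) t s) ω) atTop (𝓝 c) := by
    intro t ht s
    obtain ⟨C, hC'⟩ := D.exists_abs_bellman_le t Vmax
    -- Noise is observation minus Bellman value, bounded by `Vmax` and `C` respectively.
    set W := max (Vmax + C) 0 with hW
    have hmem : ∀ n, n + 1 ∈ Set.Icc 1 (n + 1) := fun n => ⟨by omega, le_rfl⟩
    have hvis : ∀ n, MeasurableSet[D.history X w (n + 1)] (X (n + 1) t ⁻¹' {s}) := fun n =>
      Bidding.Model.measurable_visited (hmem n) ht.le (MeasurableSet.singleton s)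
    have hle := Bidding.Model.history_le hX hw
    have hind : ∀ n, Measurable[D.history X w (n + 1)]
        ((X (n + 1) t ⁻¹' {s}).indicator (w (n + 1) t s)) := fun n => by
      -- The history records noise only at the visited state; on the event that `s` is visited, this
      -- is the noise at `s`.
      have : (X (n + 1) t ⁻¹' {s}).indicator (w (n + 1) t s) =
          (X (n + 1) t ⁻¹' {s}).indicator fun ω => w (n + 1) t (X (n + 1) t ω) ω := by
        refine Set.indicator_congr fun ω hω => ?_
        rw [show X (n + 1) t ω = s from hω]
      rw [this]
      exact (Bidding.Model.measurable_noise_visited (hmem n) ht).indicator (hvis n)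
    have ha' : ∀ n, Measurable[D.history X w (n + 1)] (a n t) := fun n =>
      (ha_meas n t ht).mono (Bidding.Model.history_mono n.le_succ) le_rfl
    have hX' : ∀ n, MeasurableSet (X (n + 1) t ⁻¹' {s}) := fun n => hle _ _ (hvis n)
    refine ae_exists_tendsto_sum_of_summable_sq (B := W)
      (ℱ := Bidding.Model.historyFiltration hX hw)
      (β := fun n ω => W * (X (n + 1) t ⁻¹' {s}).indicator (a n t) ω)
      (fun n => ((ha' n).mul (hind n)).stronglyMeasurable) (fun n => ?_)
      (fun n => ((ha' n).indicator (hvis n)).const_mul W)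
      (fun n ω => mul_nonneg (le_max_right _ _)
        (Set.indicator_nonneg (fun ω _ => (ha_mem n t ht ω).1) ω))
      (fun n ω => mul_le_of_le_one_right (le_max_right _ _)
        (Set.indicator_apply_le' (fun _ => (ha_mem n t ht ω).2) fun _ => zero_le_one))
      (fun n => ?_) ?_
    · have h0 := (hchoose n t ht s).condExp_indicator_eq_zero (hle n) (hX' n) (hw _ _ _)
        (hwint n t ht s) (hnoise n t ht s)
      have h1 := condExp_stronglyMeasurable_mul_of_bound (hle n)
        (ha_meas n t ht).stronglyMeasurable ((hwint n t ht s).indicator (hX' n)) 1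
        (Eventually.of_forall fun ω => by
          rw [Real.norm_of_nonneg (ha_mem n t ht ω).1]; exact (ha_mem n t ht ω).2)
      refine h1.trans ?_
      filter_upwards [h0] with ω h
      simp [h]
    · filter_upwards [hobs'] with ω hω
      have hest := Bidding.Model.abs_estimate_le hVmax.le hCterm
        (fun n t ht => ha_mem n t ht ω) hω
      by_cases h : X (n + 1) t ω = s
      · have hmem : ω ∈ X (n + 1) t ⁻¹' {s} := h
        rw [Set.indicator_of_mem hmem, Set.indicator_of_mem hmem, abs_mul,
          abs_of_nonneg (ha_mem n t ht ω).1, mul_comm]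
        refine mul_le_mul_of_nonneg_right (le_max_of_le_left ?_) (ha_mem n t ht ω).1
        have h1 := hω n t ht
        rw [h, Bidding.Model.observe] at h1
        have h2 := hC' _ (hest n (t + 1)) s
        rw [abs_le] at *
        constructor <;> linarith [h1.1, h1.2, h2.1, h2.2]
      · have hmem : ω ∉ X (n + 1) t ⁻¹' {s} := h
        rw [Set.indicator_of_notMem hmem, Set.indicator_of_notMem hmem]
        simp
    · filter_upwards [ha_sq t ht s] with ω hω
      simp only [mul_pow]
      exact hω.mul_left _
  intro t _ s
  -- The exceptional null sets for all times and states are discarded together, since the backward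
  -- induction runs on a single path.
  filter_upwards [
    ae_all_iff.2 fun t => ae_all_iff.2 fun ht : t < D.T => ae_all_iff.2 fun s => ha_sum t ht s,
    ae_all_iff.2 fun t => ae_all_iff.2 fun ht : t < D.T => ae_all_iff.2 fun s =>
      hnoise_sum t ht s] with ω hsum hconv
  refine Bidding.Model.tendsto_estimate hC (fun n t ht => ha_mem n t ht ω)
    (α := fun t s n => (X (n + 1) t ⁻¹' {s}).indicator (a n t) ω)
    (ξ := fun t s n => a n t ω * (X (n + 1) t ⁻¹' {s}).indicator (w (n + 1) t s) ω)
    (fun t s n h => Set.indicator_of_mem (s := X (n + 1) t ⁻¹' {s}) h _)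
    (fun t s n h => Set.indicator_of_notMem (s := X (n + 1) t ⁻¹' {s}) h _)
    (fun t s n h => ?_) (fun t s n h => ?_) hsum hconv D.T t (by omega) s
  · rw [Set.indicator_of_mem (s := X (n + 1) t ⁻¹' {s}) h]
  · rw [Set.indicator_of_notMem (s := X (n + 1) t ⁻¹' {s}) h, mul_zero]
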